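/- Let $R$ be a commutative Noetherian ring with $\dim R\le 1$ and let $\mathfrak a$ be an ideal of $R$. An $R$-module $M$ is called minimax if it has a finitely generated submodule $N$ such that $M/N$ is Artinian; it is called $\mathfrak a$-cominimax if $\operatorname{Supp}_R(M)\subseteq V(\mathfrak a)$ and $\operatorname{Ext}^i_R(R/\mathfrak a,M)$ is minimax for all $i\ge 0$. It is called $\mathfrak a$-torsion if every element of $M$ is annihilated by some power of $\mathfrak a$. Write $(0:_M\mathfrak a)=\{m\in M:\mathfrak a m=0\}$. 1. If $M$ is an $R$-module with $\operatorname{Supp}_R(M)\subseteq V(\mathfrak a)$ and $(0:_M\mathfrak a)$ is minimax, then $M$ is minimax. 2. The class of minimax $R$-modules is a Melkersson subcategory of the category of $R$-modules with respect to $\mathfrak a$; that is, for every $\mathfrak a$-torsion $R$-module $M$, if $(0:_M\mathfrak a)$ is minimax, then $M$ is minimax. 3. The class of $\mathfrak a$-cominimax $R$-modules is a Serre subcategory of the category of $R$-modules; that is, it contains the zero module and is closed under taking submodules, quotients and extensions. -/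

import Mathlib

universe u v

open CategoryTheory

/-- An `R`-module `M` is minimax if it has a finitely generated submodule `N` such that
the quotient `M ⧸ N` is Artinian. -/
def IsMinimaxModule (R : Type u) [CommRing R] (M : Type v) [AddCommGroup M] [Module R M] : Prop :=
  ∃ N : Submodule R M, N.FG ∧ IsArtinian R (M ⧸ N)

/-- The submodule `(0 :_M 𝔞) = {m ∈ M | 𝔞 m = 0}` of `M`. -/
abbrev zeroColon (R : Type u) [CommRing R] (M : Type v) [AddCommGroup M] [Module R M]
    (𝔞 : Ideal R) : Submodule R M :=
  Submodule.torsionBySet R M (𝔞 : Set R)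

/-- An `R`-module `M` is `𝔞`-torsion if every element of `M` is annihilated by a power of `𝔞`,
that is, if `Γ_𝔞(M) = M`. -/
def IsIdealTorsion (R : Type u) [CommRing R] (𝔞 : Ideal R) (M : Type v) [AddCommGroup M]
    [Module R M] : Prop :=
  ∀ m : M, ∃ n : ℕ, m ∈ zeroColon R M (𝔞 ^ n)

/-- An `R`-module `M` is `𝔞`-cominimax if `Supp M ⊆ V(𝔞)` and the `R`-module `Ext^i_R(R/𝔞, M)` is
minimax for all `i`. Here `Shrink` only moves `R ⧸ 𝔞` to the universe of `M`. -/
def IsCominimaxModule (R : Type u) [CommRing R] [Small.{v} R] (𝔞 : Ideal R) (M : Type v)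
    [AddCommGroup M] [Module R M] : Prop :=
  Module.support R M ⊆ PrimeSpectrum.zeroLocus (𝔞 : Set R) ∧
    ∀ i : ℕ, IsMinimaxModule R
      (Abelian.Ext (ModuleCat.of R (Shrink.{v} (R ⧸ 𝔞))) (ModuleCat.of R M) i)

/-- The class of minimax `R`-modules, as a full subcategory of the category of `R`-modules. -/
def minimaxModules (R : Type u) [CommRing R] : ObjectProperty (ModuleCat.{v} R) :=
  fun M => IsMinimaxModule R M

/-- The class of `𝔞`-cominimax `R`-modules, as a full subcategory of the category of
`R`-modules. -/
def cominimaxModules (R : Type u) [CommRing R] [Small.{v} R] (𝔞 : Ideal R) :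
    ObjectProperty (ModuleCat.{v} R) :=
  fun M => IsCominimaxModule R 𝔞 M

/-- A full subcategory `𝒮` of the category of `R`-modules is a Melkersson subcategory with respect
to `𝔞` if for every `𝔞`-torsion `R`-module `M`, `(0 :_M 𝔞) ∈ 𝒮` implies `M ∈ 𝒮`. -/
def IsMelkerssonSubcategory {R : Type u} [CommRing R] (𝔞 : Ideal R)
    (𝒮 : ObjectProperty (ModuleCat.{v} R)) : Prop :=
  ∀ M : ModuleCat.{v} R, IsIdealTorsion R 𝔞 M → 𝒮 (ModuleCat.of R (zeroColon R M 𝔞)) → 𝒮 M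

/-! ### Closure properties of minimax modules -/

section Minimax

variable {R : Type*} [CommRing R] {A B C : Type*} [AddCommGroup A] [Module R A]
  [AddCommGroup B] [Module R B] [AddCommGroup C] [Module R C]

/-! By Noetherianity `Ann(I ^ n)` is constant for large `n`. Fix such an `n` and set `J = I + Ann(I
^ n)`. At a minimal prime containing `I` some power of `I` localizes to zero, so no minimal prime
contains `J`; as `dim R ≤ 1`, `R ⧸ J` is Artinian. For `M` `I`-torsion with `(0 :_M I)` minimax, put
`S = I ^ n M`. Then `(0 :_S I)` is minimax and killed by `J`, hence Artinian, and Melkersson's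
criterion makes `S` Artinian. Multiplication by generators of `I ^ n` maps `M` to a power of `S`
with kernel `(0 :_M I ^ n)`, which is minimax; so `M` is minimax (`IsMinimaxModule.of_zeroColon`).
Consequently cominimax means minimax with support in `V(I)`, and both conditions are Serre. -/

theorem Submodule.exists_fg_map_eq_of_le_range (g : B →ₗ[R] C) {P : Submodule R C} (hP : P.FG)
    (hle : P ≤ LinearMap.range g) : ∃ N : Submodule R B, N.FG ∧ N.map g = P := by
  obtain ⟨s, hs, rfl⟩ := Submodule.fg_def.1 hP
  refine ⟨span R (Function.invFun g '' s), Submodule.fg_span (hs.image _), ?_⟩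
  rw [Submodule.map_span, ← Set.image_comp, Set.image_congr, Set.image_id]
  exact fun c hc ↦ Function.invFun_eq (hle (Submodule.subset_span hc))

theorem isArtinian_of_exact {f : A →ₗ[R] B} {g : B →ₗ[R] C} (h : Function.Exact f g)
    (hA : IsArtinian R A) (hC : IsArtinian R C) : IsArtinian R B :=
  isArtinian_of_range_eq_ker f g h.linearMap_ker_eq.symm

namespace IsMinimaxModule

theorem of_isArtinian (h : IsArtinian R A) : IsMinimaxModule R A :=
  ⟨⊥, Submodule.fg_bot, inferInstance⟩

theorem of_surjective (f : A →ₗ[R] B) (hf : Function.Surjective f) (hA : IsMinimaxModule R A) :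
    IsMinimaxModule R B := by
  obtain ⟨N, hN, _⟩ := hA
  refine ⟨N.map f, hN.map f, isArtinian_of_surjective _
    (N.mapQ (N.map f) f (Submodule.le_comap_map f N)) fun y ↦ ?_⟩
  obtain ⟨b, rfl⟩ := Submodule.mkQ_surjective _ y
  obtain ⟨a, rfl⟩ := hf b
  exact ⟨N.mkQ a, rfl⟩

theorem pi (ι : Type*) [Finite ι] (hA : IsMinimaxModule R A) : IsMinimaxModule R (ι → A) := by
  classical
  cases nonempty_fintype ι
  obtain ⟨N, hN, _⟩ := hA
  have : Module.Finite R N := Module.Finite.iff_fg.2 hN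
  let φ : (ι → N) →ₗ[R] (ι → A) := LinearMap.pi fun i ↦ N.subtype ∘ₗ LinearMap.proj i
  have hφ : LinearMap.range φ = Submodule.pi Set.univ fun _ ↦ N := by
    ext x
    simp only [LinearMap.mem_range, Submodule.mem_pi, Set.mem_univ, forall_true_left]
    exact ⟨fun ⟨y, hy⟩ i ↦ hy ▸ (y i).2, fun hx ↦ ⟨fun i ↦ ⟨x i, hx i⟩, rfl⟩⟩
  refine ⟨Submodule.pi Set.univ fun _ ↦ N, hφ ▸ Module.Finite.iff_fg.1 inferInstance, ?_⟩
  exact isArtinian_of_linearEquiv (Submodule.quotientPi fun _ : ι ↦ N).symm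

/-- The finitely generated submodule is a quotient of a finite power of the Artinian module `R ⧸ I`.
-/
theorem isArtinian_of_le_annihilator {I : Ideal R} [IsArtinianRing (R ⧸ I)]
    (hI : I ≤ Module.annihilator R A) (hA : IsMinimaxModule R A) : IsArtinian R A := by
  obtain ⟨N, hN, hNA⟩ := hA
  have : IsArtinian R (R ⧸ I) :=
    isArtinian_of_surjective_algebraMap (R := R ⧸ I) (S := R) Ideal.Quotient.mk_surjective
  have : Module.Finite R N := Module.Finite.iff_fg.2 hN
  obtain ⟨k, s, hs⟩ := Module.Finite.exists_fin (R := R) (M := N)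
  let φ : (Fin k → R ⧸ I) →ₗ[R] N := LinearMap.lsum R _ R fun i ↦
    I.liftQ (LinearMap.toSpanSingleton R N (s i)) fun r hr ↦
      Subtype.ext (Module.mem_annihilator.1 (hI hr) (s i : A))
  have hφ : Function.Surjective φ := by
    rw [← LinearMap.range_eq_top, ← top_le_iff, ← hs, Submodule.span_le]
    rintro _ ⟨i, rfl⟩
    refine ⟨Pi.single i (Ideal.Quotient.mk I 1), ?_⟩
    rw [LinearMap.lsum_piSingle]
    exact one_smul R (s i)
  exact (isArtinian_iff_submodule_quotient N).2 ⟨isArtinian_of_surjective _ φ hφ, hNA⟩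

variable [IsNoetherianRing R]

theorem of_exact {f : A →ₗ[R] B} {g : B →ₗ[R] C} (h : Function.Exact f g)
    (hA : IsMinimaxModule R A) (hC : IsMinimaxModule R C) : IsMinimaxModule R B := by
  obtain ⟨P, hP, _⟩ := hA
  obtain ⟨Q, hQ, _⟩ := hC
  have := isNoetherian_of_fg_of_noetherian Q hQ
  -- `g` need not be surjective, so only `Q ⊓ range g` is lifted; it is finitely generated because
  -- `Q` is Noetherian.
  obtain ⟨N, hN, hNQ⟩ := Submodule.exists_fg_map_eq_of_le_range g
    (isNoetherian_submodule.1 this (Q ⊓ LinearMap.range g) inf_le_left) inf_le_right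
  have hf : P ≤ (P.map f ⊔ N).comap f :=
    (Submodule.le_comap_map f P).trans (Submodule.comap_mono le_sup_left)
  have hg : P.map f ⊔ N ≤ Q.comap g := by
    refine sup_le ?_ ?_
    · rintro _ ⟨a, -, rfl⟩
      simp [h.apply_apply_eq_zero]
    · exact Submodule.map_le_iff_le_comap.1 (hNQ.le.trans inf_le_left)
  refine ⟨P.map f ⊔ N, (hP.map f).sup hN, isArtinian_of_exact
    (f := P.mapQ _ f hf) (g := Submodule.mapQ _ Q g hg) (fun y ↦ ?_) ‹_› ‹_›⟩
  obtain ⟨b, rfl⟩ := Submodule.mkQ_surjective _ y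
  constructor
  · intro hb
    have hb' : g b ∈ Q := by simpa using hb
    obtain ⟨n, hn, hnb⟩ : g b ∈ N.map g := hNQ ▸ ⟨hb', b, rfl⟩
    obtain ⟨a, ha⟩ := (h (b - n)).1 (by simp [hnb])
    refine ⟨P.mkQ a, ?_⟩
    have : f a - b ∈ P.map f ⊔ N :=
      Submodule.mem_sup_right (by rw [ha]; simpa using hn)
    simpa using (Submodule.Quotient.eq _).2 this
  · rintro ⟨x, hx⟩
    obtain ⟨a, rfl⟩ := Submodule.mkQ_surjective _ x
    rw [← hx]
    simp [h.apply_apply_eq_zero]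

theorem of_injective (f : A →ₗ[R] B) (hf : Function.Injective f) (hB : IsMinimaxModule R B) :
    IsMinimaxModule R A :=
  of_exact (f := (0 : PUnit →ₗ[R] A)) (g := f)
    (fun x ↦ by simp [map_eq_zero_iff f hf, eq_comm])
    (of_isArtinian inferInstance) hB

/-- Multiplication by `k` generators of `I` maps `T` to `S ^ k`, with kernel `(0 :_A I) ⊓ T`. -/
theorem of_smul_le {I : Ideal R} {S T : Submodule R A} (hI : I • T ≤ S)
    (h0 : IsMinimaxModule R (zeroColon R A I)) (hS : IsMinimaxModule R S) :
    IsMinimaxModule R T := by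
  obtain ⟨k, a, rfl⟩ := Submodule.fg_iff_exists_fin_generating_family.1 (IsNoetherian.noetherian I)
  let f : ↥(zeroColon R A (Ideal.span (Set.range a)) ⊓ T) →ₗ[R] T :=
    Submodule.inclusion inf_le_right
  let g : T →ₗ[R] (Fin k → S) := LinearMap.pi fun i ↦
    (LinearMap.lsmul R A (a i)).restrict fun t ht ↦
      hI (Submodule.smul_mem_smul (Submodule.subset_span (Set.mem_range_self i)) ht)
  refine of_exact (f := f) (g := g) (fun t ↦ ?_)
    (of_injective (Submodule.inclusion inf_le_left) (Submodule.inclusion_injective _) h0)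
    (pi (Fin k) hS)
  have key : (t : A) ∈ zeroColon R A (Ideal.span (Set.range a)) ↔ ∀ i, a i • (t : A) = 0 := by
    rw [zeroColon, Ideal.span, ← Submodule.torsionBySet_eq_torsionBySet_span,
      Submodule.mem_torsionBySet_iff]
    simp
  constructor
  · intro h
    refine ⟨⟨t, key.2 fun i ↦ ?_, t.2⟩, rfl⟩
    exact congrArg Subtype.val (congrFun h i)
  · rintro ⟨t, rfl⟩
    ext i
    exact key.1 t.2.1 i

theorem zeroColon_pow {I : Ideal R} (h : IsMinimaxModule R (zeroColon R A I)) (n : ℕ) :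
    IsMinimaxModule R (zeroColon R A (I ^ n)) := by
  induction n with
  | zero =>
    have : zeroColon R A (I ^ 0) = ⊥ := by simp [zeroColon, Submodule.torsionBySet_univ]
    rw [this]
    exact of_isArtinian inferInstance
  | succ n ih =>
    refine of_smul_le (Submodule.smul_le.2 fun r hr m hm ↦ ?_) h ih
    rw [Submodule.mem_torsionBySet_iff] at hm ⊢
    rintro ⟨s, hs⟩
    rw [smul_smul]
    exact hm ⟨s * r, pow_succ I n ▸ Ideal.mul_mem_mul hs hr⟩

end IsMinimaxModule

end Minimax

/-! ### Melkersson's Artinianness criterion -/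

section Melkersson

variable {R : Type*} [CommRing R]

/-- For a descending chain `L i`, the submodules `K i n = x ^ n L i ∩ (0 : x)` decrease in both
indices. If they stabilize in `i` uniformly in `n`, so does the chain. -/
theorem isArtinian_of_isArtinian_torsionBy {M : Type*} [AddCommGroup M] [Module R M] (x : R)
    (hx : ∀ m : M, ∃ n : ℕ, x ^ n • m = 0) (h : IsArtinian R (Submodule.torsionBy R M x)) :
    IsArtinian R M := by
  rw [← monotone_stabilizes_iff_artinian]
  intro L
  let L' : ℕ → Submodule R M := fun i ↦ L i
  have hL : Antitone L' := fun i j hij ↦ L.monotone hij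
  let K : ℕ → ℕ → Submodule R (Submodule.torsionBy R M x) := fun i n ↦
    ((L' i).map (LinearMap.lsmul R M (x ^ n))).comap (Submodule.torsionBy R M x).subtype
  have hK : ∀ {i j n k}, i ≤ j → n ≤ k → K j k ≤ K i n := by
    rintro i j n k hij hnk ⟨y, hy⟩ ⟨m, hm, hmy⟩
    obtain ⟨d, rfl⟩ := Nat.exists_eq_add_of_le hnk
    refine ⟨x ^ d • m, (L' i).smul_mem _ (hL hij hm), ?_⟩
    simpa [smul_smul, pow_add, mul_comm] using hmy
  have stab : ∀ F : ℕ → Submodule R (Submodule.torsionBy R M x), Antitone F →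
      ∃ n, ∀ m, n ≤ m → F n = F m := fun F hF ↦
    IsArtinian.monotone_stabilizes ⟨fun i ↦ OrderDual.toDual (F i), fun i j hij ↦ hF hij⟩
  -- Stability of the diagonal from `a` on handles every `n ≥ a`; the finitely many rows `n < a` are
  -- stabilized one by one.
  obtain ⟨a, ha⟩ := stab (fun i ↦ K i i) fun i j hij ↦ hK hij hij
  choose b hb using fun n ↦ stab (fun i ↦ K i n) fun i j hij ↦ hK hij le_rfl
  let c := a ⊔ (Finset.range a).sup b
  have hc : ∀ i, c ≤ i → ∀ n, K c n ≤ K i n := by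
    intro i hi n
    rcases lt_or_ge n a with hn | hn
    · have hbc : b n ≤ c := (Finset.le_sup (f := b) (Finset.mem_range.2 hn)).trans le_sup_right
      exact ((hb n c hbc).symm.trans (hb n i (hbc.trans hi))).le
    · have hac : a ≤ c := le_sup_left
      calc K c n ≤ K a a := hK hac hn
        _ = K (i ⊔ n) (i ⊔ n) := ha _ (hn.trans le_sup_right)
        _ ≤ K i n := hK le_sup_left le_sup_right
  refine ⟨c, fun i hi ↦ le_antisymm (α := Submodule R M) ?_ (hL hi)⟩
  suffices H : ∀ n, ∀ m ∈ L' c, x ^ n • m = 0 → m ∈ L' i by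
    intro m hm
    obtain ⟨n, hn⟩ := hx m
    exact H n m hm hn
  intro n
  induction n with
  | zero =>
    intro m _ h0
    rw [show m = 0 by simpa using h0]
    exact zero_mem _
  | succ n ih =>
    intro m hm h0
    have hm' : (⟨x ^ n • m, by
        rw [Submodule.mem_torsionBy_iff, smul_smul, ← pow_succ', h0]⟩ :
        Submodule.torsionBy R M x) ∈ K c n := ⟨m, hm, rfl⟩
    obtain ⟨m', hm', he⟩ := hc i hi n hm'
    have he : x ^ n • m' = x ^ n • m := he
    -- Subtracting `m' ∈ L i` lowers the exponent: `x ^ n` kills `m - m'`.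
    have := ih (m - m') (sub_mem hm (hL hi hm')) (by rw [smul_sub, he, sub_self])
    simpa using add_mem this hm'

theorem isArtinian_of_isArtinian_torsionBySet_finset (s : Finset R) :
    ∀ {M : Type v} [AddCommGroup M] [Module R M], (∀ m : M, ∀ x ∈ s, ∃ n : ℕ, x ^ n • m = 0) →
      IsArtinian R (Submodule.torsionBySet R M (s : Set R)) → IsArtinian R M := by
  classical
  induction s using Finset.induction_on with
  | empty =>
    intro M _ _ _ h
    exact isArtinian_of_surjective _ (Submodule.subtype _) fun m ↦
      ⟨⟨m, (Submodule.mem_torsionBySet_iff _ _).2 fun a ↦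
        absurd a.2 (Finset.notMem_empty _)⟩, rfl⟩
  | insert x s _ ih =>
    intro M _ _ hM h
    refine ih (fun m y hy ↦ hM m y (Finset.mem_insert_of_mem hy)) ?_
    refine isArtinian_of_isArtinian_torsionBy x (fun m ↦ ?_) ?_
    · obtain ⟨n, hn⟩ := hM m x (Finset.mem_insert_self x s)
      exact ⟨n, Subtype.ext hn⟩
    · let N := Submodule.torsionBySet R M (s : Set R)
      let φ : Submodule.torsionBy R N x →ₗ[R] M :=
        N.subtype ∘ₗ (Submodule.torsionBy R N x).subtype
      refine isArtinian_of_injective (φ.codRestrict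
        (Submodule.torsionBySet R M (↑(insert x s) : Set R)) fun m ↦ ?_) ?_
      · rw [Submodule.mem_torsionBySet_iff]
        rintro ⟨y, hy⟩
        rcases Finset.mem_insert.1 (Finset.mem_coe.1 hy) with rfl | hy
        · exact congrArg Subtype.val m.2
        · exact (Submodule.mem_torsionBySet_iff _ _).1 m.1.2 ⟨y, hy⟩
      · intro m m' h
        have h' : ((m : N) : M) = ((m' : N) : M) :=
          congrArg (Submodule.torsionBySet R M (↑(insert x s) : Set R)).subtype h
        exact Subtype.ext (Subtype.ext h')

/-- Melkersson's criterion. -/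
theorem IsIdealTorsion.isArtinian {I : Ideal R} (hI : I.FG) {M : Type v} [AddCommGroup M]
    [Module R M] (hM : IsIdealTorsion R I M) (h : IsArtinian R (zeroColon R M I)) :
    IsArtinian R M := by
  obtain ⟨s, rfl⟩ := hI
  refine isArtinian_of_isArtinian_torsionBySet_finset s (fun m x hx ↦ ?_) ?_
  · obtain ⟨n, hn⟩ := hM m
    exact ⟨n, (Submodule.mem_torsionBySet_iff _ _).1 hn
      ⟨x ^ n, Ideal.pow_mem_pow (Submodule.subset_span hx) n⟩⟩
  · rwa [Submodule.torsionBySet_eq_torsionBySet_span]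

theorem isIdealTorsion_of_support_subset [IsNoetherianRing R] {I : Ideal R} {M : Type v}
    [AddCommGroup M] [Module R M]
    (h : Module.support R M ⊆ PrimeSpectrum.zeroLocus (I : Set R)) : IsIdealTorsion R I M := by
  intro m
  have hs := (Module.support_subset_of_injective (Submodule.span R {m}).subtype
    (Submodule.subtype_injective _)).trans h
  rw [Module.support_eq_zeroLocus, PrimeSpectrum.zeroLocus_subset_zeroLocus_iff] at hs
  obtain ⟨n, hn⟩ := Ideal.exists_pow_le_of_le_radical_of_fg hs (IsNoetherian.noetherian I)
  refine ⟨n, (Submodule.mem_torsionBySet_iff _ _).2 fun a ↦ ?_⟩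
  exact congrArg Subtype.val
    (Module.mem_annihilator.1 (hn a.2) ⟨m, Submodule.mem_span_singleton_self m⟩)

end Melkersson

/-! ### Rings of dimension at most one -/

section DimensionOne

variable {R : Type*} [CommRing R] [IsNoetherianRing R]

/-- The maximal ideal of `R_p` is its nilradical, so some `I ^ k` vanishes in `R_p`; thus `p` is
outside the support of the finite module `I ^ k`. -/
theorem Ideal.exists_annihilator_pow_not_le {p : Ideal R} (hp : p ∈ minimalPrimes R)
    {I : Ideal R} (hI : I ≤ p) : ∃ k : ℕ, ¬ Module.annihilator R ↥(I ^ k) ≤ p := by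
  have := hp.1.1
  have hr := IsLocalization.AtPrime.radical_map_of_mem_minimalPrimes
    (A := Localization.AtPrime p) p ⊥ hp
  have hIr : I ≤ (RingHom.ker (algebraMap R (Localization.AtPrime p))).radical := by
    rw [RingHom.ker, ← Ideal.comap_radical, ← Ideal.map_le_iff_le_comap]
    rw [Ideal.map_bot] at hr
    exact hr ▸ Ideal.map_mono hI
  obtain ⟨k, hk⟩ := Ideal.exists_pow_le_of_le_radical_of_fg hIr (IsNoetherian.noetherian I)
  refine ⟨k, fun hle ↦ ?_⟩
  have hmem : (⟨p, this⟩ : PrimeSpectrum R) ∈ Module.support R ↥(I ^ k) :=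
    Module.mem_support_iff_of_finite.2 hle
  rw [Module.mem_support_iff'] at hmem
  obtain ⟨x, hx⟩ := hmem
  obtain ⟨r, hr⟩ := (IsLocalization.map_eq_zero_iff p.primeCompl (Localization.AtPrime p) _).1
    (hk x.2)
  exact hx r r.2 (Subtype.ext hr)

theorem Ideal.exists_isArtinianRing_quotient_sup_annihilator_pow (hdim : ringKrullDim R ≤ 1)
    (I : Ideal R) : ∃ n : ℕ, IsArtinianRing (R ⧸ (I ⊔ Module.annihilator R ↥(I ^ n))) := by
  have hmono : Monotone fun n ↦ Module.annihilator R ↥(I ^ n) := fun i j hij ↦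
    (Submodule.inclusion (Ideal.pow_le_pow_right hij)).annihilator_le_of_injective
      (Submodule.inclusion_injective _)
  obtain ⟨n, hn⟩ := monotone_stabilizes_iff_noetherian.2 ‹IsNoetherianRing R› ⟨_, hmono⟩
  refine ⟨n, isArtinianRing_iff_krullDimLE_zero.2 (Ring.KrullDimLE.mk₀ fun q hq ↦ ?_)⟩
  let p := q.comap (Ideal.Quotient.mk (I ⊔ Module.annihilator R ↥(I ^ n)))
  have hle : I ⊔ Module.annihilator R ↥(I ^ n) ≤ p := fun x hx ↦ by
    simp [p, Ideal.mem_comap, Ideal.Quotient.eq_zero_iff_mem.2 hx]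
  have hpm : p.IsMaximal := by
    -- A prime is minimal or maximal. Were `p` minimal, some `Ann(I ^ k)` would escape `p`, yet it
    -- lies in the stable value `Ann(I ^ n) ≤ p`.
    refine ((Ring.krullDimLE_one_iff.1 (Ring.krullDimLE_iff.2 hdim)) p inferInstance).resolve_left
      fun hmin ↦ ?_
    obtain ⟨k, hk⟩ := Ideal.exists_annihilator_pow_not_le hmin (le_sup_left.trans hle)
    refine hk ((hmono (le_max_right n k)).trans ?_)
    exact (hn _ (le_max_left n k)).ge.trans (le_sup_right.trans hle)
  rw [← Ideal.map_comap_of_surjective _ Ideal.Quotient.mk_surjective q]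
  exact hpm.map_of_surjective_of_ker_le Ideal.Quotient.mk_surjective (by simpa using hle)

theorem IsMinimaxModule.of_zeroColon (hdim : ringKrullDim R ≤ 1) {I : Ideal R} {M : Type v}
    [AddCommGroup M] [Module R M] (hM : IsIdealTorsion R I M)
    (h : IsMinimaxModule R (zeroColon R M I)) : IsMinimaxModule R M := by
  obtain ⟨n, hn⟩ := Ideal.exists_isArtinianRing_quotient_sup_annihilator_pow hdim I
  let S : Submodule R M := I ^ n • ⊤
  have hS : ∀ r ∈ Module.annihilator R ↥(I ^ n), ∀ m ∈ S, r • m = 0 := by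
    intro r hr m hm
    refine Submodule.smul_induction_on hm (fun s hs m _ ↦ ?_) fun x y hx hy ↦ ?_
    · have : r * s = 0 := congrArg Subtype.val (Module.mem_annihilator.1 hr ⟨s, hs⟩)
      rw [smul_smul, this, zero_smul]
    · rw [smul_add, hx, hy, add_zero]
  have hST : IsIdealTorsion R I S := fun m ↦ by
    obtain ⟨k, hk⟩ := hM m
    exact ⟨k, (Submodule.mem_torsionBySet_iff _ _).2 fun a ↦
      Subtype.ext ((Submodule.mem_torsionBySet_iff _ _).1 hk a)⟩
  have hS0 : IsMinimaxModule R (zeroColon R S I) :=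
    .of_injective (S.subtype.restrict (p := zeroColon R S I) (q := zeroColon R M I) fun m hm ↦
      (Submodule.mem_torsionBySet_iff _ _).2 fun a ↦
        congrArg Subtype.val ((Submodule.mem_torsionBySet_iff _ _).1 hm a))
      (fun x y hxy ↦ by
        have hxy' : ((x : S) : M) = ((y : S) : M) :=
          congrArg (zeroColon R M I).subtype hxy
        exact Subtype.ext (Subtype.ext hxy')) h
  have hSA : IsArtinian R S := by
    refine hST.isArtinian (IsNoetherian.noetherian I) (hS0.isArtinian_of_le_annihilator
      (I := I ⊔ Module.annihilator R ↥(I ^ n)) (sup_le (fun r hr ↦ ?_) fun r hr ↦ ?_))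
    · exact Module.mem_annihilator.2 fun m ↦
        Subtype.ext ((Submodule.mem_torsionBySet_iff _ _).1 m.2 ⟨r, hr⟩)
    · exact Module.mem_annihilator.2 fun m ↦ Subtype.ext (Subtype.ext (hS r hr _ m.1.2))
  have htop : IsMinimaxModule R (⊤ : Submodule R M) :=
    .of_smul_le (S := S) le_rfl (h.zeroColon_pow n) (.of_isArtinian hSA)
  exact .of_surjective (Submodule.topEquiv : _ ≃ₗ[R] M).toLinearMap
    Submodule.topEquiv.surjective htop

end DimensionOne

/-! ### Cominimax modules and the Serre property -/

section Cominimax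

variable {R : Type u} [CommRing R] [IsNoetherianRing R] [Small.{v} R]

open Abelian

theorem IsMinimaxModule.ext (N M : ModuleCat.{v} R) [Module.Finite R N]
    (hM : IsMinimaxModule R M) (i : ℕ) : IsMinimaxModule R (Ext N M i) := by
  induction i generalizing N with
  | zero =>
    obtain ⟨k, s, hs⟩ := Module.Finite.exists_fin (R := R) (M := N)
    let e : Ext N M 0 ≃ₗ[R] (N →ₗ[R] M) := Ext.linearEquiv₀.trans ModuleCat.homLinearEquiv
    let ev : (N →ₗ[R] M) →ₗ[R] (Fin k → M) := LinearMap.pi fun i ↦ LinearMap.applyₗ (s i)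
    refine .of_injective (ev ∘ₗ e.toLinearMap)
      (Function.Injective.comp (g := ev) (fun f g h ↦ ?_) e.injective) (.pi (Fin k) hM)
    exact LinearMap.ext_on_range hs fun i ↦ congrFun h i
  | succ n ih =>
    obtain ⟨N, _, _, _, _, f, surjf⟩ := Module.exists_finite_presentation R N
    let exac := LinearMap.shortExact_shortComplexKer surjf
    -- Dimension shifting: the connecting map from `Ext^n` of the syzygy, again finite, is onto.
    exact .of_surjective (exac.extClass.precompOfLinear R M (add_comm 1 n))
      (precomp_extClass_surjective_of_projective_X₂ M exac n) (ih _)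

/-- Only `Ext^0` is needed for the forward direction, since `(0 :_M I)` embeds in `Hom(R ⧸ I, M)`.
-/
theorem isCominimaxModule_iff (hdim : ringKrullDim R ≤ 1) (I : Ideal R) (M : Type v)
    [AddCommGroup M] [Module R M] : IsCominimaxModule R I M ↔
      Module.support R M ⊆ PrimeSpectrum.zeroLocus (I : Set R) ∧ IsMinimaxModule R M := by
  let e : Shrink.{v} (R ⧸ I) ≃ₗ[R] R ⧸ I := Shrink.linearEquiv R (R ⧸ I)
  refine and_congr_right fun hsupp ↦ ⟨fun h ↦ ?_, fun h i ↦ ?_⟩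
  · refine .of_zeroColon hdim (isIdealTorsion_of_support_subset hsupp) ?_
    let φ : zeroColon R M I →ₗ[R] (R ⧸ I →ₗ[R] M) :=
      { toFun := fun m ↦ I.liftQ (LinearMap.toSpanSingleton R M m) fun r hr ↦
          (Submodule.mem_torsionBySet_iff _ _).1 m.2 ⟨r, hr⟩
        map_add' := fun m m' ↦ Submodule.linearMap_qext _
          (LinearMap.ext fun r ↦ smul_add r (m : M) m')
        map_smul' := fun r m ↦ Submodule.linearMap_qext _
          (LinearMap.ext fun s ↦ smul_comm s r (m : M)) }
    have hφ : Function.Injective φ := fun m m' h ↦ by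
      have := LinearMap.congr_fun h (Ideal.Quotient.mk I 1)
      exact Subtype.ext ((one_smul R (m : M)).symm.trans (this.trans (one_smul R (m' : M))))
    let ψ : (R ⧸ I →ₗ[R] M) ≃ₗ[R]
        Ext (ModuleCat.of R (Shrink.{v} (R ⧸ I))) (ModuleCat.of R M) 0 :=
      (e.symm.congrLeft M R).trans (Ext.linearEquiv₀.trans ModuleCat.homLinearEquiv).symm
    exact .of_injective (ψ.toLinearMap ∘ₗ φ) (ψ.injective.comp hφ) (h 0)
  · have : Module.Finite R (Shrink.{v} (R ⧸ I)) := Module.Finite.equiv e.symm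
    exact .ext _ _ h i

theorem isSerreClass_cominimaxModules (hdim : ringKrullDim R ≤ 1) (I : Ideal R) :
    (cominimaxModules.{u, v} R I).IsSerreClass where
  exists_zero := ⟨ModuleCat.of R PUnit, ModuleCat.isZero_of_subsingleton _,
    (isCominimaxModule_iff hdim I _).2
      ⟨by simp [Module.support_eq_empty], .of_isArtinian inferInstance⟩⟩
  prop_of_mono f _ hY := by
    have hf := (ModuleCat.mono_iff_injective f).1 inferInstance
    obtain ⟨h, h'⟩ := (isCominimaxModule_iff hdim I _).1 hY
    exact (isCominimaxModule_iff hdim I _).2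
      ⟨(Module.support_subset_of_injective f.hom hf).trans h, .of_injective f.hom hf h'⟩
  prop_of_epi f _ hX := by
    have hf := (ModuleCat.epi_iff_surjective f).1 inferInstance
    obtain ⟨h, h'⟩ := (isCominimaxModule_iff hdim I _).1 hX
    exact (isCominimaxModule_iff hdim I _).2
      ⟨(Module.support_subset_of_surjective f.hom hf).trans h, .of_surjective f.hom hf h'⟩
  prop_X₂_of_shortExact {S} hS h₁ h₃ := by
    have hex := (ShortComplex.ShortExact.moduleCat_exact_iff_function_exact S).1 hS.exact
    obtain ⟨h₁, h₁'⟩ := (isCominimaxModule_iff hdim I _).1 h₁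
    obtain ⟨h₃, h₃'⟩ := (isCominimaxModule_iff hdim I _).1 h₃
    refine (isCominimaxModule_iff hdim I _).2 ⟨?_, .of_exact hex h₁' h₃'⟩
    rw [Module.support_of_exact hex hS.moduleCat_injective_f hS.moduleCat_surjective_g]
    exact Set.union_subset h₁ h₃

end Cominimax

theorem proposition3p4 (R : Type u) [CommRing R] [IsNoetherianRing R] [Small.{v} R]
    (hdim : ringKrullDim R ≤ 1) (𝔞 : Ideal R) :
    (∀ (M : Type v) [AddCommGroup M] [Module R M],
      Module.support R M ⊆ PrimeSpectrum.zeroLocus (𝔞 : Set R) →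
      IsMinimaxModule R (zeroColon R M 𝔞) → IsMinimaxModule R M) ∧
    IsMelkerssonSubcategory 𝔞 (minimaxModules.{u, v} R) ∧
    (cominimaxModules.{u, v} R 𝔞).IsSerreClass :=
  ⟨fun _ _ _ hsupp h ↦ .of_zeroColon hdim (isIdealTorsion_of_support_subset hsupp) h,
    fun _ hM h ↦ IsMinimaxModule.of_zeroColon hdim hM h, isSerreClass_cominimaxModules hdim 𝔞⟩
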